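/- Let $S$ be a complete separable metric space, $M_1(S)$ the space of its Borel probability measures (with the $\sigma$-algebra generated by the maps $\nu\mapsto\nu(B)$), and $\xi=\{\xi_{ij}:i,j\in\mathbb N\}$ an array of $S$-valued random variables on a probability space. Assume that $\xi$ is row exchangeable: $\{\xi_{\sigma(i),\tau_i(j)}\}$ and $\{\xi_{ij}\}$ have the same finite-dimensional distributions for all finite permutations $\sigma,\tau_1,\tau_2,\dots$ of $\mathbb N$. Then there are almost surely unique random probability measures $\mu_1,\mu_2,\dots$ on $S$, the row distributions of $\xi$, such that for each $i$, given $\mu_i$, the row $(\xi_{i1},\xi_{i2},\dots)$ is i.i.d. with distribution $\mu_i$, that is, $\mathcal L(\xi_{i1},\xi_{i2},\dots\mid\mu_i)=\mu_i^\infty$. Let $M,N,N'\in\mathbb N$ with $N<N'$, and write $X_{iN}=(\xi_{i1},\dots,\xi_{iN})$ and $\mathbf X_{MN}=(X_{1N},\dots,X_{MN})$. Then the posterior predictive law $\mathcal L(\xi_{ij}: i\le M,\ N<j\le N'\mid \mathbf X_{MN})$ is entirely determined by the conditional laws $\mathcal L(\mu_m\mid X_{mN},\dots,X_{MN},\mu_1,\dots,\mu_{m-1})$,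 $1\le m\le M$. Explicitly, these conditional laws exist as probability kernels, and if, for each $m$, the probability kernel $Q_m$ is any version of the $m$-th one, so that $$\mathcal L(\mu_m\mid X_{mN},\dots,X_{MN},\mu_1,\dots,\mu_{m-1})=Q_m(X_{mN},\dots,X_{MN},\mu_1,\dots,\mu_{m-1};\,\cdot\,)\quad\text{a.s.},$$ then $$\mathcal L(\xi_{ij}: i\le M,\ N<j\le N'\mid \mathbf X_{MN})=\Pi_Q(\mathbf X_{MN};\,\cdot\,)\quad\text{a.s.},$$ where $\Pi_Q$ is the probability kernel that depends only on $Q_1,\dots,Q_M$ (and $M,N,N'$) and is given for $x=(x_1,\dots,x_M)\in (S^N)^M$ by $$\Pi_Q(x;\,\cdot\,)=\int\cdots\int \Big(\prod_{i=1}^M \nu_i^{\,N'-N}\Big)(\,\cdot\,)\;Q_M(x_M,\nu_1,\dots,\nu_{M-1};d\nu_M)\cdots Q_2(x_2,\dots,x_M,\nu_1;d\nu_2)\,Q_1(x_1,\dots,x_M;d\nu_1).$$ -/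

import Mathlib

open MeasureTheory ProbabilityTheory

/-- A permutation of `ℕ` is finite if it moves only finitely many points. -/
def IsFinitePerm (σ : Equiv.Perm ℕ) : Prop := {n | σ n ≠ n}.Finite

/-- The array `ξ i j` is row exchangeable: permuting the rows by `σ` and, independently in each
row `i`, the entries by `τ i` (all of these finite permutations) leaves the law of the array
unchanged. Laws of arrays are measures on the product space `ℕ → ℕ → S`, so equality of laws
is equality of all finite-dimensional distributions. -/
def RowExchangeable {Ω S : Type*} [MeasurableSpace Ω] [MeasurableSpace S]
    (P : Measure Ω) (ξ : ℕ → ℕ → Ω → S) : Prop :=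
  ∀ (σ : Equiv.Perm ℕ) (τ : ℕ → Equiv.Perm ℕ), IsFinitePerm σ → (∀ i, IsFinitePerm (τ i)) →
    P.map (fun ω i j => ξ (σ i) (τ i j) ω) = P.map (fun ω i j => ξ i j ω)

theorem measurable_iid {S : Type*} [MeasurableSpace S] :
    Measurable (fun ν : ProbabilityMeasure S =>
      Measure.infinitePi (fun _ : ℕ => (ν : Measure S))) := by
  refine Measurable.measure_of_isPiSystem_of_isProbabilityMeasure
    (S := squareCylinders (fun _ : ℕ => {s : Set S | MeasurableSet s}))
    (generateFrom_squareCylinders).symm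
    (isPiSystem_squareCylinders (fun _ => MeasurableSpace.isPiSystem_measurableSet)
      (fun _ => MeasurableSet.univ)) ?_
  rintro _ ⟨s, t, ht, rfl⟩
  have h : ∀ ν : ProbabilityMeasure S,
      Measure.infinitePi (fun _ : ℕ => (ν : Measure S)) ((s : Set ℕ).pi t)
        = ∏ i ∈ s, (ν : Measure S) (t i) := fun ν =>
    Measure.infinitePi_pi _ (fun i _ => ht i (Set.mem_univ i))
  simp only [h]
  exact Finset.measurable_prod _ fun i _ =>
    (Measure.measurable_coe (ht i (Set.mem_univ i))).comp measurable_subtype_coe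

theorem measurable_pi_of_measurable {ι T : Type*} [Fintype ι] {E : ι → Type*}
    [MeasurableSpace T] [∀ i, MeasurableSpace (E i)] (f : ∀ i, T → Measure (E i))
    [∀ i t, IsProbabilityMeasure (f i t)] (hf : ∀ i, Measurable (f i)) :
    Measurable (fun t => Measure.pi (fun i => f i t)) := by
  refine Measurable.measure_of_isPiSystem_of_isProbabilityMeasure
    generateFrom_pi.symm isPiSystem_pi ?_
  rintro _ ⟨s, hs, rfl⟩
  simp only [Measure.pi_pi]
  exact Finset.measurable_prod _ fun i _ =>
    (Measure.measurable_coe (hs i (Set.mem_univ i))).comp (hf i)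

/-- The probability kernel `ν ↦ ν^∞` from `M₁(S)` to `S^∞`: the law of an i.i.d. sequence with
marginal distribution `ν`. -/
noncomputable def iidKernel (S : Type*) [MeasurableSpace S] :
    Kernel (ProbabilityMeasure S) (ℕ → S) where
  toFun ν := Measure.infinitePi (fun _ : ℕ => (ν : Measure S))
  measurable' := measurable_iid

/-- `μ 0, μ 1, …` are row distributions of `ξ`: each `μ i` is a random probability measure
and, given `μ i`, the `i`-th row of `ξ` is i.i.d. with distribution `μ i`, that is,
`L(ξ_i | μ_i) = μ_i^∞`. -/
def IsRowDistributions {Ω S : Type*} [MeasurableSpace Ω] [MeasurableSpace S]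
    (P : Measure Ω) (ξ : ℕ → ℕ → Ω → S) (μ : ℕ → Ω → ProbabilityMeasure S) : Prop :=
  ∀ i, Measurable (μ i) ∧ HasCondDistrib (fun ω j => ξ i j ω) (μ i) (iidKernel S) P

/-- The space of `M × N` data matrices (`M` rows of `N` observations). -/
abbrev DataMatrix (S : Type*) (M N : ℕ) : Type _ := Fin M → Fin N → S

/-- The observed data matrix: the first `N` entries of each of the first `M` rows. -/
def dataMatrix {Ω S : Type*} (ξ : ℕ → ℕ → Ω → S) (M N : ℕ) (ω : Ω) : DataMatrix S M N :=
  fun i j => ξ i j ω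

/-- The entries to be predicted: those with column index `N ≤ j < N'` (counted from `0`) in the
first `M` rows. -/
def futureEntries {Ω S : Type*} (ξ : ℕ → ℕ → Ω → S) (M N N' : ℕ) (ω : Ω) :
    Fin M → Finset.Ico N N' → S :=
  fun i j => ξ i j ω

/-- The space of conditioning values at stage `m` (counted from `0`): the data in rows
`m, …, M - 1`, and `m` probability measures. -/
abbrev StageInput (S : Type*) [MeasurableSpace S] (M N : ℕ) (m : Fin M) : Type _ :=
  ({i : Fin M // m ≤ i} → Fin N → S) × (Fin m → ProbabilityMeasure S)

/-- The conditioning variable at stage `m`: the data in rows `m, …, M - 1`, together with the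
row distributions of the rows `0, …, m - 1`. -/
def stageInput {Ω S : Type*} [MeasurableSpace S] (ξ : ℕ → ℕ → Ω → S)
    (μ : ℕ → Ω → ProbabilityMeasure S) (M N : ℕ) (m : Fin M) (ω : Ω) : StageInput S M N m :=
  (fun i j => ξ i.1 j ω, fun k => μ k ω)

/-- Forgets the data in the rows before `m`. -/
def restrictInput {S : Type*} [MeasurableSpace S] (M N : ℕ) (m : Fin M)
    (p : DataMatrix S M N × (Fin m → ProbabilityMeasure S)) : StageInput S M N m :=
  (fun i => p.1 i.1, p.2)

theorem measurable_restrictInput {S : Type*} [MeasurableSpace S] (M N : ℕ) (m : Fin M) :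
    Measurable (restrictInput (S := S) M N m) := by
  unfold restrictInput
  fun_prop

/-- The successive composition of the kernels `Q 0, …, Q (m - 1)`: from a data matrix `x`, draw
`ν 0` from `Q 0 (x)`, then `ν 1` from `Q 1 (rows 1, … of x, ν 0)`, and so on; the result is
the law of `(ν 0, …, ν (m - 1))`. -/
noncomputable def jointKernel {S : Type*} [MeasurableSpace S] {M N : ℕ}
    (Q : (m : Fin M) → Kernel (StageInput S M N m) (ProbabilityMeasure S)) :
    (m : ℕ) → m ≤ M → Kernel (DataMatrix S M N) (Fin m → ProbabilityMeasure S)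
  | 0, _ => Kernel.const _ (Measure.dirac Fin.elim0)
  | m + 1, h =>
      (jointKernel Q m (Nat.le_of_succ_le h) ⊗ₖ
        (Q ⟨m, h⟩).comap (restrictInput M N ⟨m, h⟩) (measurable_restrictInput M N ⟨m, h⟩)).map
        (fun p => (Fin.snoc p.1 p.2 : Fin (m + 1) → ProbabilityMeasure S))

/-- The kernel `ν ↦ ν_0^(N'-N) × ⋯ × ν_(M-1)^(N'-N)`. -/
noncomputable def productKernel (S : Type*) [MeasurableSpace S] (M N N' : ℕ) :
    Kernel (Fin M → ProbabilityMeasure S) (Fin M → Finset.Ico N N' → S) where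
  toFun ν := Measure.pi (fun i => Measure.pi (fun _ : Finset.Ico N N' => (ν i : Measure S)))
  measurable' :=
    measurable_pi_of_measurable
      (fun (i : Fin M) (ν : Fin M → ProbabilityMeasure S) =>
        Measure.pi (fun _ : Finset.Ico N N' => (ν i : Measure S)))
      fun i => measurable_pi_of_measurable
        (fun (_ : Finset.Ico N N') (ν : Fin M → ProbabilityMeasure S) => (ν i : Measure S))
        fun _ => measurable_subtype_coe.comp (measurable_pi_apply i)

/-- The predictive kernel computed from `Q`: the mixture
`x ↦ ∫ (ν_0^(N'-N) × ⋯ × ν_(M-1)^(N'-N)) Q_0(x; dν_0) ⋯ Q_(M-1)(x, ν_0, …; dν_(M-1))`. -/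
noncomputable def predictiveKernel {S : Type*} [MeasurableSpace S] {M N : ℕ} (N' : ℕ)
    (Q : (m : Fin M) → Kernel (StageInput S M N m) (ProbabilityMeasure S)) :
    Kernel (DataMatrix S M N) (Fin M → Finset.Ico N N' → S) :=
  productKernel S M N N' ∘ₖ jointKernel Q M le_rfl

open scoped ENNReal

/-! Three facts carry the result. (1) De Finetti for each row,
`IsExchangeable.hasCondDistrib_iidKernel`. Exchangeability extends to all injections of the index
set, so the conditional law of an entry given all later entries is, by an L² argument, unchanged
when some of these are dropped. This invariant conditional law is the directing measure, a
measurable function of the row. By the strong law of large numbers it is a.s. the only one.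

(2) The rows are conditionally independent given the row distributions. Each row stays exchangeable
on any event defined by the other rows, and uniqueness forces its directing measure there to be the
same `μ i`; so the other rows say nothing more about row `i` once `μ i` is known
(`hasCondDistrib_iidKernel_prodMk`, `IsRowDistributions.lintegral_prod_indicator`).

(3) Hence, given the stage `m` input, the data in rows before `m` are conditionally independent of
`μ m`, and `Q m` is also the conditional law of `μ m` given the full data matrix and the earlier row
distributions (`IsRowDistributions.hasCondDistrib_stage`). The chain rule for kernels gives the
posterior of all `M` row distributions. Given these, future entries are independent of the data with
the product law, and integrating out the row distributions gives the predictive kernel. -/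

/-! ### Exchangeable laws on sequences: cylinders and injections -/

theorem exists_isFinitePerm_eqOn {f : ℕ → ℕ} (hf : f.Injective) (n : ℕ) :
    ∃ τ : Equiv.Perm ℕ, IsFinitePerm τ ∧ ∀ j < n, τ j = f j := by
  classical
  obtain ⟨K, hK⟩ : ∃ K, ∀ j < n, j < K ∧ f j < K := by
    refine ⟨n + (∑ j ∈ Finset.range n, f j) + 1, fun j hj => ⟨by omega, ?_⟩⟩
    have := Finset.single_le_sum (f := f) (fun _ _ => Nat.zero_le _) (Finset.mem_range.2 hj)
    omega
  -- The value `j` in the second case is a dummy: for `j < n` the choice of `K` gives `f j < K`.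
  let g : Fin K → Fin K := fun j => if h : f j < K then ⟨f j, h⟩ else j
  have hg : ∀ j : Fin K, (j : ℕ) < n → (g j : ℕ) = f j := fun j hj => by
    simp [g, (hK j hj).2]
  obtain ⟨e, he⟩ := Finset.exists_equiv_extend_of_card_eq (α := Fin K) (t := Finset.univ)
    (by simp) (s := Finset.univ.filter fun j : Fin K => (j : ℕ) < n) (f := g)
    (Finset.subset_univ _) (by
      intro a ha b hb hab
      simp only [Finset.coe_filter, Finset.mem_univ, true_and, Set.mem_ofPred_eq] at ha hb
      have := congrArg Fin.val hab
      rw [hg a ha, hg b hb] at this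
      exact Fin.ext (hf this))
  let e' : Equiv.Perm (Fin K) := e.trans (Equiv.subtypeUnivEquiv fun x => Finset.mem_univ x)
  refine ⟨e'.extendDomain Fin.equivSubtype, ?_, fun j hj => ?_⟩
  · refine (Set.finite_lt_nat K).subset fun j hj => ?_
    by_contra hjK
    exact hj (Equiv.Perm.extendDomain_apply_not_subtype _ _ hjK)
  · have h := Equiv.Perm.extendDomain_apply_image e' Fin.equivSubtype (⟨j, (hK j hj).1⟩ : Fin K)
    have h1 := he ⟨j, (hK j hj).1⟩ (by simpa using hj)
    have h2 := hg ⟨j, (hK j hj).1⟩ hj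
    rw [← h1] at h2
    exact h.trans h2

/-- A measure on sequences is exchangeable if it is invariant under finite permutations. -/
def IsExchangeable {S : Type*} [MeasurableSpace S] (ρ : Measure (ℕ → S)) : Prop :=
  ∀ τ : Equiv.Perm ℕ, IsFinitePerm τ → ρ.map (fun x j => x (τ j)) = ρ

/-- Padding with `Set.univ` replaces the finite index set by an initial segment, which makes
induction on the number of coordinates possible. -/
theorem exists_cylinder_of_mem_squareCylinders {S : Type*} [MeasurableSpace S] {B : Set (ℕ → S)}
    (hB : B ∈ squareCylinders (fun _ : ℕ => {s : Set S | MeasurableSet s})) :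
    ∃ (n : ℕ) (A : ℕ → Set S), (∀ j, MeasurableSet (A j)) ∧ B = {x | ∀ j < n, x j ∈ A j} := by
  classical
  obtain ⟨s, t, ht, rfl⟩ := hB
  obtain ⟨n, hn⟩ : ∃ n, ∀ j ∈ s, j < n :=
    ⟨s.sup id + 1, fun j hj => Nat.lt_succ_of_le (Finset.le_sup (f := id) hj)⟩
  refine ⟨n, fun j => if j ∈ s then t j else Set.univ, fun j => ?_, ?_⟩
  · dsimp only
    split_ifs
    exacts [ht j (Set.mem_univ j), MeasurableSet.univ]
  · ext x
    simp only [Set.mem_pi, Finset.mem_coe, Set.mem_ofPred_eq]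
    refine ⟨fun hx j _ => ?_, fun hx j hj => ?_⟩
    · split_ifs with hj
      exacts [hx j hj, trivial]
    · simpa [hj] using hx j (hn j hj)

theorem measure_ext_of_cylinders {S : Type*} [MeasurableSpace S] {ρ ρ' : Measure (ℕ → S)}
    [IsFiniteMeasure ρ]
    (h : ∀ (n : ℕ) (A : ℕ → Set S), (∀ j, MeasurableSet (A j)) →
      ρ {x | ∀ j < n, x j ∈ A j} = ρ' {x | ∀ j < n, x j ∈ A j}) : ρ = ρ' := by
  refine ext_of_generate_finite _ (generateFrom_squareCylinders).symm
    (isPiSystem_squareCylinders (fun _ => MeasurableSpace.isPiSystem_measurableSet)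
      (fun _ => MeasurableSet.univ)) (fun B hB => ?_) ?_
  · obtain ⟨n, A, hA, rfl⟩ := exists_cylinder_of_mem_squareCylinders hB
    exact h n A hA
  · simpa using h 0 (fun _ => Set.univ) fun _ => MeasurableSet.univ

theorem measurableSet_cylinder {S : Type*} [MeasurableSpace S] (n : ℕ) {A : ℕ → Set S}
    (hA : ∀ j, MeasurableSet (A j)) : MeasurableSet {x : ℕ → S | ∀ j < n, x j ∈ A j} := by
  have : {x : ℕ → S | ∀ j < n, x j ∈ A j} = ⋂ j, ⋂ _ : j < n, (fun x => x j) ⁻¹' A j := by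
    ext; simp
  rw [this]
  exact MeasurableSet.iInter fun j => MeasurableSet.iInter fun _ => measurable_pi_apply j (hA j)

/-- A cylinder sees finitely many coordinates, and on these an injection agrees with a finite
permutation. The gain is that `f` need not be surjective: shifts and deletions of coordinates are
allowed. -/
theorem IsExchangeable.map_injective {S : Type*} [MeasurableSpace S] {ρ : Measure (ℕ → S)}
    [IsFiniteMeasure ρ] (hρ : IsExchangeable ρ) {f : ℕ → ℕ} (hf : f.Injective) :
    ρ.map (fun x j => x (f j)) = ρ := by
  refine measure_ext_of_cylinders fun n A hA => ?_
  obtain ⟨τ, hτ, hτf⟩ := exists_isFinitePerm_eqOn hf n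
  conv_rhs => rw [← hρ τ hτ]
  rw [Measure.map_apply (by fun_prop) (measurableSet_cylinder n hA),
    Measure.map_apply (by fun_prop) (measurableSet_cylinder n hA)]
  congr 1
  ext x
  simp only [Set.mem_preimage, Set.mem_ofPred_eq]
  exact forall₂_congr fun j hj => by rw [hτf j hj]

/-! ### Conditional laws tested by integrals -/

/-- Kernels which agree almost surely on every measurable set agree almost surely. -/
theorem kernel_ae_eq_of_forall {α β : Type*} [MeasurableSpace α] [MeasurableSpace β]
    [MeasurableSpace.CountableOrCountablyGenerated α β] {μ : Measure α} [IsFiniteMeasure μ]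
    {κ η : Kernel α β} [IsFiniteKernel κ] [IsFiniteKernel η]
    (h : ∀ A, MeasurableSet A → ∀ᵐ a ∂μ, κ a A = η a A) : ∀ᵐ a ∂μ, κ a = η a := by
  refine Kernel.ae_eq_of_compProd_eq (Measure.ext_prod fun {s t} hs ht => ?_)
  rw [Measure.compProd_apply_prod hs ht, Measure.compProd_apply_prod hs ht]
  exact lintegral_congr_ae (ae_restrict_of_ae (h t ht))

theorem lintegral_hasCondDistrib {Ω α β : Type*} [MeasurableSpace Ω] [MeasurableSpace α]
    [MeasurableSpace β] {P : Measure Ω} [SFinite P] {X : Ω → α} {Y : Ω → β} {κ : Kernel α β}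
    [IsSFiniteKernel κ] (h : HasCondDistrib Y X κ P) {f : α → β → ℝ≥0∞}
    (hf : Measurable (Function.uncurry f)) :
    ∫⁻ ω, f (X ω) (Y ω) ∂P = ∫⁻ ω, ∫⁻ y, f (X ω) y ∂κ (X ω) ∂P := by
  have hX := h.aemeasurable_fst
  have hY := h.aemeasurable_snd
  calc ∫⁻ ω, f (X ω) (Y ω) ∂P = ∫⁻ p, Function.uncurry f p ∂(P.map fun ω => (X ω, Y ω)) := by
        rw [lintegral_map' hf.aemeasurable (by fun_prop)]; rfl
    _ = ∫⁻ ω, ∫⁻ y, f (X ω) y ∂κ (X ω) ∂P := by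
        rw [h.map_eq, Measure.lintegral_compProd hf]
        exact lintegral_map' (Measurable.lintegral_kernel_prod_right hf).aemeasurable hX

theorem lintegral_mul_indicator_hasCondDistrib {Ω α β : Type*} [MeasurableSpace Ω]
    [MeasurableSpace α] [MeasurableSpace β] {P : Measure Ω} [SFinite P] {X : Ω → α} {Y : Ω → β}
    {κ : Kernel α β} [IsSFiniteKernel κ] (h : HasCondDistrib Y X κ P) {f : α → ℝ≥0∞}
    (hf : Measurable f) {A : Set β} (hA : MeasurableSet A) :
    ∫⁻ ω, f (X ω) * A.indicator 1 (Y ω) ∂P = ∫⁻ ω, f (X ω) * κ (X ω) A ∂P := by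
  have h1 : Measurable (A.indicator (1 : β → ℝ≥0∞)) := measurable_one.indicator hA
  rw [lintegral_hasCondDistrib h (f := fun x y => f x * A.indicator 1 y)
    ((hf.comp measurable_fst).mul (h1.comp measurable_snd))]
  refine lintegral_congr fun ω => ?_
  rw [lintegral_const_mul _ h1, lintegral_indicator_one hA]

theorem hasCondDistrib_of_lintegral {Ω α β : Type*} [MeasurableSpace Ω]
    [MeasurableSpace α] [MeasurableSpace β] {P : Measure Ω} [IsFiniteMeasure P] {X : Ω → α}
    {Y : Ω → β} {κ : Kernel α β} [IsFiniteKernel κ] (hX : Measurable X) (hY : Measurable Y)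
    {C : Set (Set β)} (hC : ‹MeasurableSpace β› = MeasurableSpace.generateFrom C)
    (hpi : IsPiSystem C) (huniv : Set.univ ∈ C)
    (h : ∀ f : α → ℝ≥0∞, Measurable f → ∀ A ∈ C,
      ∫⁻ ω, f (X ω) * A.indicator 1 (Y ω) ∂P = ∫⁻ ω, f (X ω) * κ (X ω) A ∂P) :
    HasCondDistrib Y X κ P := by
  refine ⟨by fun_prop, ?_⟩
  have key : ∀ s, MeasurableSet s → ∀ A ∈ C,
      P.map (fun ω => (X ω, Y ω)) (s ×ˢ A) = (P.map X ⊗ₘ κ) (s ×ˢ A) := by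
    intro s hs A hA
    have hA' : MeasurableSet A := hC ▸ MeasurableSpace.measurableSet_generateFrom hA
    rw [Measure.compProd_apply_prod hs hA', Measure.map_apply (by fun_prop) (hs.prod hA'),
      ← lintegral_indicator hs, lintegral_map ((κ.measurable_coe hA').indicator hs) hX,
      ← lintegral_indicator_one ((hX.prodMk hY) (hs.prod hA'))]
    have := h (s.indicator 1) (measurable_one.indicator hs) A hA
    convert this using 2
    · ext ω
      by_cases h1 : X ω ∈ s <;> by_cases h2 : Y ω ∈ A <;> simp [h1, h2]
    · ext ω
      by_cases h1 : X ω ∈ s <;> simp [h1]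
  refine ext_of_generate_finite (Set.image2 (· ×ˢ ·) {s : Set α | MeasurableSet s} C) ?_
    (MeasurableSpace.isPiSystem_measurableSet.prod hpi) ?_ ?_
  · exact (generateFrom_eq_prod MeasurableSpace.generateFrom_measurableSet hC.symm
      ⟨fun _ => Set.univ, fun _ => MeasurableSet.univ, Set.iUnion_const _⟩
      ⟨fun _ => Set.univ, fun _ => huniv, Set.iUnion_const _⟩).symm
  · rintro _ ⟨s, hs, A, hA, rfl⟩
    exact key s hs A hA
  · rw [← Set.univ_prod_univ]
    exact key _ MeasurableSet.univ _ huniv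

/-- The hypotheses say that the integral of `(a - b)²` vanishes. To avoid subtraction in `ℝ≥0∞`, the
proof compares `2ab ≤ a² + b²` with equal finite integrals. -/
theorem ae_eq_of_lintegral_mul_self_eq {Ω : Type*} [MeasurableSpace Ω] {P : Measure Ω}
    [IsFiniteMeasure P] {a b : Ω → ℝ≥0∞} (ha : Measurable a) (hb : Measurable b)
    (ha1 : ∀ ω, a ω ≤ 1) (hb1 : ∀ ω, b ω ≤ 1)
    (hab : ∫⁻ ω, b ω * a ω ∂P = ∫⁻ ω, b ω * b ω ∂P)
    (haa : ∫⁻ ω, a ω * a ω ∂P = ∫⁻ ω, b ω * b ω ∂P) : a =ᵐ[P] b := by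
  have hle : ∀ x y : ℝ≥0∞, x ≤ 1 → y ≤ 1 → y * x + y * x ≤ x * x + y * y ∧
      (y * x + y * x = x * x + y * y → x = y) := by
    intro x y hx hy
    lift x to NNReal using (hx.trans_lt ENNReal.one_lt_top).ne
    lift y to NNReal using (hy.trans_lt ENNReal.one_lt_top).ne
    norm_cast
    refine ⟨?_, fun h => ?_⟩
    · rw [← NNReal.coe_le_coe]
      push_cast
      nlinarith [sq_nonneg ((x : ℝ) - y)]
    · have h' := congrArg NNReal.toReal h
      push_cast at h'
      have : ((x : ℝ) - y) ^ 2 = 0 := by linarith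
      exact NNReal.eq (sub_eq_zero.1 (pow_eq_zero_iff (two_ne_zero) |>.1 this))
  have hfin : ∫⁻ ω, b ω * b ω ∂P ≠ ∞ := by
    refine ((lintegral_mono fun ω => mul_le_one' (hb1 ω) (hb1 ω)).trans_lt ?_).ne
    simp [measure_lt_top]
  have h1 : ∫⁻ ω, (b ω * a ω + b ω * a ω) ∂P = ∫⁻ ω, b ω * b ω ∂P + ∫⁻ ω, b ω * b ω ∂P := by
    rw [lintegral_add_left (by fun_prop), hab]
  have h2 : ∫⁻ ω, (a ω * a ω + b ω * b ω) ∂P = ∫⁻ ω, b ω * b ω ∂P + ∫⁻ ω, b ω * b ω ∂P := by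
    rw [lintegral_add_left (by fun_prop), haa]
  have := ae_eq_of_ae_le_of_lintegral_le
    (Filter.Eventually.of_forall fun ω => (hle (a ω) (b ω) (ha1 ω) (hb1 ω)).1)
    (by rw [h1]; exact ENNReal.add_ne_top.2 ⟨hfin, hfin⟩)
    ((ha.mul ha).add (hb.mul hb)).aemeasurable (by rw [h1, h2])
  filter_upwards [this] with ω hω
  exact (hle _ _ (ha1 ω) (hb1 ω)).2 hω

/-- Being a conditional law depends only on the joint law, so it transfers between probability
spaces. -/
theorem hasCondDistrib_of_map_eq {Ω Ω' α β : Type*} [MeasurableSpace Ω] [MeasurableSpace Ω']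
    [MeasurableSpace α] [MeasurableSpace β] {P : Measure Ω} {P' : Measure Ω'}
    {X : Ω → α} {Y : Ω → β} {X' : Ω' → α} {Y' : Ω' → β} {κ : Kernel α β}
    (h : HasCondDistrib Y X κ P) (hX' : AEMeasurable X' P') (hY' : AEMeasurable Y' P')
    (he : P'.map (fun ω => (X' ω, Y' ω)) = P.map (fun ω => (X ω, Y ω))) :
    HasCondDistrib Y' X' κ P' := by
  refine ⟨by fun_prop, ?_⟩
  have hX := h.aemeasurable_fst
  have hY := h.aemeasurable_snd
  have : P'.map X' = P.map X := by
    have := congrArg Measure.fst he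
    rwa [Measure.fst_map_prodMk₀ hY', Measure.fst_map_prodMk₀ hY] at this
  rw [he, h.map_eq, this]

instance isMarkovKernel_iidKernel {S : Type*} [MeasurableSpace S] :
    IsMarkovKernel (iidKernel S) :=
  ⟨fun ν => inferInstanceAs (IsProbabilityMeasure (Measure.infinitePi fun _ => (ν : Measure S)))⟩

theorem iidKernel_apply {S : Type*} [MeasurableSpace S] (ν : ProbabilityMeasure S) :
    iidKernel S ν = Measure.infinitePi (fun _ : ℕ => (ν : Measure S)) := rfl

theorem iidKernel_cylinder {S : Type*} [MeasurableSpace S] (ν : ProbabilityMeasure S) (n : ℕ)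
    {A : ℕ → Set S} (hA : ∀ j, MeasurableSet (A j)) :
    iidKernel S ν {x | ∀ j < n, x j ∈ A j} = ∏ j ∈ Finset.range n, (ν : Measure S) (A j) := by
  rw [iidKernel_apply, ← Measure.infinitePi_pi _ (fun j _ => hA j)]
  congr 1
  ext x
  simp

theorem IsExchangeable.measurePreserving_shift {S : Type*} [MeasurableSpace S]
    {ρ : Measure (ℕ → S)} [IsFiniteMeasure ρ] (hρ : IsExchangeable ρ) (n : ℕ) :
    MeasurePreserving (fun (x : ℕ → S) j => x (j + n)) ρ ρ :=
  ⟨by fun_prop, hρ.map_injective (add_left_injective n)⟩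

/-! ### De Finetti's theorem -/

section Directing

variable {S : Type*} [MeasurableSpace S] [StandardBorelSpace S] [Nonempty S]

/-- The conditional law of the first entry of a sequence given the other entries. -/
noncomputable def tailKernel (ρ : Measure (ℕ → S)) [IsFiniteMeasure ρ] : Kernel (ℕ → S) S :=
  condDistrib (fun x : ℕ → S => x 0) (fun x j => x (j + 1)) ρ

instance (ρ : Measure (ℕ → S)) [IsFiniteMeasure ρ] : IsMarkovKernel (tailKernel ρ) := by
  unfold tailKernel; infer_instance

variable {ρ : Measure (ℕ → S)} [IsFiniteMeasure ρ]

theorem hasCondDistrib_tailKernel :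
    HasCondDistrib (fun x : ℕ → S => x 0) (fun x j => x (j + 1)) (tailKernel ρ) ρ := by
  refine ⟨by fun_prop, ?_⟩
  rw [tailKernel, compProd_map_condDistrib (measurable_pi_apply 0).aemeasurable]

theorem IsExchangeable.hasCondDistrib_tailKernel_comp (hρ : IsExchangeable ρ) {f : ℕ → ℕ}
    (hf : f.Injective) :
    HasCondDistrib (fun x : ℕ → S => x (f 0)) (fun x j => x (f (j + 1))) (tailKernel ρ) ρ := by
  refine hasCondDistrib_of_map_eq hasCondDistrib_tailKernel
    (Measurable.aemeasurable (by fun_prop)) (Measurable.aemeasurable (by fun_prop)) ?_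
  conv_rhs => rw [← hρ.map_injective hf, Measure.map_map (by fun_prop) (by fun_prop)]
  rfl

/-- The conditional probability `b` of `x 0 ∈ A` given `x 2, x 3, …` is the projection of the one,
`a`, given `x 1, x 2, …`. Both have the same law by shift invariance, hence the same L² norm, and a
projection that keeps the norm changes nothing. -/
theorem IsExchangeable.tailKernel_shift_one (hρ : IsExchangeable ρ) :
    ∀ᵐ x ∂ρ, tailKernel ρ x = tailKernel ρ (fun j => x (j + 1)) := by
  set κ := tailKernel ρ
  have hθ : Measurable (fun (x : ℕ → S) j => x (j + 1)) := by fun_prop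
  refine kernel_ae_eq_of_forall (η := κ.comap _ hθ) fun A hA => ?_
  simp only [Kernel.comap_apply]
  have hm : Measurable fun x => κ x A := κ.measurable_coe hA
  -- This injection omits only the index 1, so that `h2` conditions `x 0` on `x 2, x 3, …`.
  let f : ℕ → ℕ := fun j => if j = 0 then 0 else j + 1
  have hf : f.Injective := fun i j h => by simp only [f] at h; split_ifs at h <;> omega
  have h1 := lintegral_mul_indicator_hasCondDistrib (hasCondDistrib_tailKernel (ρ := ρ))
    (hm.comp hθ) hA
  have h2 := lintegral_mul_indicator_hasCondDistrib (hρ.hasCondDistrib_tailKernel_comp hf) hm hA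
  have h3 := (hρ.measurePreserving_shift 1).lintegral_comp
    (f := fun x => κ (fun j => x (j + 1)) A * κ (fun j => x (j + 1)) A)
    ((hm.comp hθ).mul (hm.comp hθ))
  have key := ae_eq_of_lintegral_mul_self_eq (P := ρ) (a := fun x => κ (fun j => x (j + 1)) A)
    (b := fun x => κ (fun j => x (j + 1 + 1)) A) (hm.comp hθ) (hm.comp (by fun_prop))
    (fun _ => prob_le_one) (fun _ => prob_le_one) (h1.symm.trans h2) h3.symm
  have hp := hρ.measurePreserving_shift 1
  -- `key` compares the kernel at the first and second shifts of `x`; as the shift preserves `ρ`,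
  -- one shift can be removed.
  rw [← hp.map_eq]
  exact (ae_map_iff hp.measurable.aemeasurable
    (measurableSet_eq_fun hm (hm.comp hθ))).2 key

theorem IsExchangeable.tailKernel_shift (hρ : IsExchangeable ρ) (n : ℕ) :
    ∀ᵐ x ∂ρ, tailKernel ρ (fun j => x (j + n)) = tailKernel ρ x := by
  induction n with
  | zero => simp
  | succ n ih =>
    filter_upwards [ih, (hρ.measurePreserving_shift n).quasiMeasurePreserving.ae
      hρ.tailKernel_shift_one] with x h1 h2
    rw [← h1, h2]
    simp only [add_assoc, add_comm n 1]

/-- In the induction the test function, which sees coordinates from `n` on, absorbs the indicator of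
`x n ∈ A n`. The kernels produced for the first `n` entries are then evaluated at the shift by `n +
1`, so that everything but this indicator is a function of the entries after `n`, and conditioning
on them yields the last factor. -/
theorem IsExchangeable.lintegral_shift_mul_indicator_cylinder (hρ : IsExchangeable ρ)
    {A : ℕ → Set S} (hA : ∀ j, MeasurableSet (A j)) (n : ℕ) {h : (ℕ → S) → ℝ≥0∞}
    (hh : Measurable h) :
    ∫⁻ x, h (fun j => x (j + n)) * {x | ∀ j < n, x j ∈ A j}.indicator 1 x ∂ρ =
      ∫⁻ x, h (fun j => x (j + n)) * ∏ j ∈ Finset.range n, tailKernel ρ x (A j) ∂ρ := by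
  set κ := tailKernel ρ
  induction n generalizing h with
  | zero => simp
  | succ n ih =>
    have hm : ∀ j, Measurable fun x => κ x (A j) := fun j => κ.measurable_coe (hA j)
    have hi : Measurable ((A n).indicator (1 : S → ℝ≥0∞)) := measurable_one.indicator (hA n)
    calc ∫⁻ x, h (fun j => x (j + (n + 1))) * {x | ∀ j < n + 1, x j ∈ A j}.indicator 1 x ∂ρ
      _ = ∫⁻ x, (fun t => h (fun j => t (j + 1)) * (A n).indicator 1 (t 0)) (fun j => x (j + n)) *
            {x | ∀ j < n, x j ∈ A j}.indicator 1 x ∂ρ := by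
          refine lintegral_congr fun x => ?_
          have hx : x ∈ {x | ∀ j < n + 1, x j ∈ A j} ↔
              x n ∈ A n ∧ x ∈ {x | ∀ j < n, x j ∈ A j} := by
            simp only [Set.mem_ofPred_eq]
            exact Nat.forall_lt_succ_right.trans and_comm
          have hi : {x | ∀ j < n + 1, x j ∈ A j}.indicator (1 : (ℕ → S) → ℝ≥0∞) x =
              (A n).indicator 1 (x n) * {x | ∀ j < n, x j ∈ A j}.indicator 1 x := by
            classical
            simp only [Set.indicator_apply, hx]
            by_cases h1 : x n ∈ A n <;> by_cases h2 : x ∈ {x | ∀ j < n, x j ∈ A j} <;>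
              simp [h1, h2, -Set.mem_ofPred_eq]
          rw [hi]
          simp [mul_assoc, add_assoc, add_comm 1 n]
      _ = ∫⁻ x, (h (fun j => x (j + (n + 1))) * (A n).indicator 1 (x n)) *
            ∏ j ∈ Finset.range n, κ x (A j) ∂ρ := by
          rw [ih (h := fun t => h (fun j => t (j + 1)) * (A n).indicator 1 (t 0))
            ((hh.comp (by fun_prop)).mul (hi.comp (by fun_prop)))]
          simp [add_assoc, add_comm 1 n]
      _ = ∫⁻ x, (h (fun j => x (j + (n + 1))) *
            ∏ j ∈ Finset.range n, κ (fun j => x (j + (n + 1))) (A j)) *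
              (A n).indicator 1 (x n) ∂ρ := by
          refine lintegral_congr_ae ?_
          filter_upwards [hρ.tailKernel_shift (n + 1)] with x hx
          rw [hx]
          ring
      _ = ∫⁻ x, (h (fun j => x (j + (n + 1))) *
            ∏ j ∈ Finset.range n, κ (fun j => x (j + (n + 1))) (A j)) *
              κ (fun j => x (j + (n + 1))) (A n) ∂ρ := by
          have := lintegral_mul_indicator_hasCondDistrib
            (hρ.hasCondDistrib_tailKernel_comp (add_left_injective n))
            (f := fun t => h t * ∏ j ∈ Finset.range n, κ t (A j))
            (hh.mul (Finset.measurable_prod _ fun j _ => hm j)) (hA n)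
          simpa [add_assoc, add_comm 1 n] using this
      _ = _ := by
          refine lintegral_congr_ae ?_
          filter_upwards [hρ.tailKernel_shift (n + 1)] with x hx
          rw [hx, Finset.prod_range_succ, mul_assoc]

/-- The conditional law `tailKernel ρ` as a map into the space of probability measures. -/
noncomputable def directingMeasure (ρ : Measure (ℕ → S)) [IsFiniteMeasure ρ] (x : ℕ → S) :
    ProbabilityMeasure S :=
  ⟨tailKernel ρ x, inferInstance⟩

theorem coe_directingMeasure (x : ℕ → S) :
    (directingMeasure ρ x : Measure S) = tailKernel ρ x := rfl

theorem measurable_directingMeasure : Measurable (directingMeasure ρ) :=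
  (tailKernel ρ).measurable.subtype_mk

theorem IsExchangeable.directingMeasure_shift (hρ : IsExchangeable ρ) (n : ℕ) :
    ∀ᵐ x ∂ρ, directingMeasure ρ (fun j => x (j + n)) = directingMeasure ρ x := by
  filter_upwards [hρ.tailKernel_shift n] with x hx
  exact Subtype.ext hx

/-- **De Finetti's theorem**: an exchangeable sequence is i.i.d. given its directing measure,
a random probability measure which is a measurable function of the sequence. -/
theorem IsExchangeable.hasCondDistrib_iidKernel (hρ : IsExchangeable ρ) :
    HasCondDistrib id (directingMeasure ρ) (iidKernel S) ρ := by
  refine hasCondDistrib_of_lintegral measurable_directingMeasure measurable_id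
    generateFrom_squareCylinders.symm
    (isPiSystem_squareCylinders (fun _ => MeasurableSpace.isPiSystem_measurableSet)
      (fun _ => MeasurableSet.univ)) ⟨∅, fun _ => Set.univ, by simp⟩ ?_
  rintro f hf B hB
  obtain ⟨n, A, hA, rfl⟩ := exists_cylinder_of_mem_squareCylinders hB
  -- A function of the directing measure is a.s. shift invariant, hence admissible as a test
  -- function of the entries from `n` on.
  have h := hρ.lintegral_shift_mul_indicator_cylinder hA n (hf.comp (measurable_directingMeasure (ρ := ρ)))
  refine (lintegral_congr_ae ?_).trans (h.trans (lintegral_congr_ae ?_)) <;>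
  · filter_upwards [hρ.directingMeasure_shift n] with x hx
    simp only [Function.comp_apply, hx, id, iidKernel_cylinder _ n hA, coe_directingMeasure]

end Directing

theorem hasCondDistrib_congr_ae {Ω α β : Type*} [MeasurableSpace Ω]
    [MeasurableSpace α] [MeasurableSpace β] {P : Measure Ω} {X X' : Ω → α} {Y : Ω → β}
    {κ : Kernel α β} (h : HasCondDistrib Y X κ P) (hX : X =ᵐ[P] X') :
    HasCondDistrib Y X' κ P := by
  refine hasCondDistrib_of_map_eq h (h.aemeasurable_fst.congr hX) h.aemeasurable_snd
    (Measure.map_congr ?_)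
  filter_upwards [hX] with ω hω
  rw [hω]

/-! ### Uniqueness of the directing measure -/

section LawOfLargeNumbers

variable {Ω S : Type*} [MeasurableSpace Ω] [MeasurableSpace S]

theorem ae_infinitePi_tendsto_average (ν : ProbabilityMeasure S) {A : Set S}
    (hA : MeasurableSet A) :
    ∀ᵐ x ∂iidKernel S ν, Filter.Tendsto
      (fun n : ℕ => (∑ j ∈ Finset.range n, A.indicator (1 : S → ℝ) (x j)) / n) Filter.atTop
      (nhds ((ν : Measure S).real A)) := by
  rw [iidKernel_apply]
  set Q := Measure.infinitePi (fun _ : ℕ => (ν : Measure S))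
  have hi : Measurable (A.indicator (1 : S → ℝ)) := measurable_one.indicator hA
  have hind : iIndepFun (fun (j : ℕ) (x : ℕ → S) => A.indicator (1 : S → ℝ) (x j)) Q :=
    iIndepFun_infinitePi (P := fun _ : ℕ => (ν : Measure S))
      (X := fun _ => A.indicator (1 : S → ℝ)) fun _ => hi
  have hev : ∀ j, Q.map (fun x : ℕ → S => x j) = ν :=
    fun j => Measure.infinitePi_map_eval (fun _ : ℕ => (ν : Measure S)) j
  have hint : Integrable (A.indicator (1 : S → ℝ)) (ν : Measure S) :=
    (integrable_const (1 : ℝ)).indicator hA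
  have h := strong_law_ae_real (μ := Q)
    (fun (j : ℕ) (x : ℕ → S) => A.indicator (1 : S → ℝ) (x j)) ?_
    (fun i j hij => hind.indepFun hij) ?_
  · have he : ∫ x, A.indicator (1 : S → ℝ) (x 0) ∂Q = (ν : Measure S).real A := by
      rw [← integral_map (f := A.indicator (1 : S → ℝ)) (φ := fun x : ℕ → S => x 0)
        (measurable_pi_apply 0).aemeasurable hi.aestronglyMeasurable, hev,
        integral_indicator_one hA]
    rwa [he] at h
  · have : Integrable (A.indicator (1 : S → ℝ)) (Q.map (fun x : ℕ → S => x 0)) := by rwa [hev]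
    exact this.comp_measurable (measurable_pi_apply 0)
  · intro j
    have : IdentDistrib (fun x : ℕ → S => x j) (fun x : ℕ → S => x 0) Q Q :=
      ⟨(measurable_pi_apply j).aemeasurable, (measurable_pi_apply 0).aemeasurable, by
        rw [hev, hev]⟩
    exact this.comp hi

theorem ae_tendsto_average_of_hasCondDistrib_iidKernel {P : Measure Ω} [SFinite P]
    {η : Ω → ℕ → S} {μ : Ω → ProbabilityMeasure S} (h : HasCondDistrib η μ (iidKernel S) P)
    {A : Set S} (hA : MeasurableSet A) :
    ∀ᵐ ω ∂P, Filter.Tendsto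
      (fun n : ℕ => (∑ j ∈ Finset.range n, A.indicator (1 : S → ℝ) (η ω j)) / n) Filter.atTop
      (nhds ((μ ω : Measure S).real A)) := by
  have hi : Measurable (A.indicator (1 : S → ℝ)) := measurable_one.indicator hA
  let avg : ℕ → ProbabilityMeasure S × (ℕ → S) → ℝ := fun n p =>
    (∑ j ∈ Finset.range n, A.indicator (1 : S → ℝ) (p.2 j)) / n
  have hr : Measurable fun p : ProbabilityMeasure S × (ℕ → S) => (p.1 : Measure S).real A :=
    ((Measure.measurable_coe hA).comp (measurable_subtype_coe.comp measurable_fst)).ennreal_toReal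
  have hs : MeasurableSet {p : ProbabilityMeasure S × (ℕ → S) |
      Filter.Tendsto (fun n => avg n p) Filter.atTop (nhds ((p.1 : Measure S).real A))} :=
    measurableSet_tendsto_fun (fun n => by fun_prop) hr
  have h2 : ∀ᵐ p ∂(P.map μ ⊗ₘ iidKernel S),
      Filter.Tendsto (fun n => avg n p) Filter.atTop (nhds ((p.1 : Measure S).real A)) := by
    rw [Measure.ae_compProd_iff hs]
    exact Filter.Eventually.of_forall fun ν => ae_infinitePi_tendsto_average ν hA
  rw [← h.map_eq] at h2
  exact ae_of_ae_map h.aemeasurable h2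

/-- Both random measures are limits of the empirical frequencies of `η`. Two measures `P' ≪ P` are
allowed because `P'` will be the restriction of `P` to an event. -/
theorem ae_eq_of_hasCondDistrib_iidKernel [MeasurableSpace.CountablyGenerated S]
    {P P' : Measure Ω} [IsFiniteMeasure P'] [SFinite P] (hP : P' ≪ P)
    {η : Ω → ℕ → S} {μ μ' : Ω → ProbabilityMeasure S} (hμ : Measurable μ) (hμ' : Measurable μ')
    (h : HasCondDistrib η μ (iidKernel S) P) (h' : HasCondDistrib η μ' (iidKernel S) P') :
    μ =ᵐ[P'] μ' := by
  let κ : Kernel Ω S := ⟨fun ω => μ ω, measurable_subtype_coe.comp hμ⟩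
  let κ' : Kernel Ω S := ⟨fun ω => μ' ω, measurable_subtype_coe.comp hμ'⟩
  have : IsMarkovKernel κ := ⟨fun ω => inferInstanceAs (IsProbabilityMeasure (μ ω : Measure S))⟩
  have : IsMarkovKernel κ' := ⟨fun ω => inferInstanceAs (IsProbabilityMeasure (μ' ω : Measure S))⟩
  have hk : ∀ᵐ ω ∂P', κ ω = κ' ω := kernel_ae_eq_of_forall fun A hA => by
    filter_upwards [hP.ae_le (ae_tendsto_average_of_hasCondDistrib_iidKernel h hA),
      ae_tendsto_average_of_hasCondDistrib_iidKernel h' hA] with ω h1 h2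
    exact (measureReal_eq_measureReal_iff).1 (tendsto_nhds_unique h1 h2)
  filter_upwards [hk] with ω hω
  exact Subtype.ext hω

end LawOfLargeNumbers

/-! ### Enlarging the conditioning of an exchangeable sequence -/

section Conditioning

variable {Ω S E : Type*} [MeasurableSpace Ω] [MeasurableSpace S] [StandardBorelSpace S]
  [Nonempty S] [MeasurableSpace E] {P : Measure Ω} [IsFiniteMeasure P]

theorem IsExchangeable.hasCondDistrib_directingMeasure {η : Ω → ℕ → S} (hη : Measurable η)
    (h : IsExchangeable (P.map η)) :
    HasCondDistrib η (fun ω => directingMeasure (P.map η) (η ω)) (iidKernel S) P := by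
  have hm := measurable_directingMeasure (ρ := P.map η)
  refine hasCondDistrib_of_map_eq h.hasCondDistrib_iidKernel (hm.comp hη).aemeasurable
    hη.aemeasurable ?_
  rw [Measure.map_map (by fun_prop) hη]
  rfl

/-- If a sequence is exchangeable jointly with `Z`, then it is i.i.d. also given its directing
measure and `Z`. -/
theorem hasCondDistrib_iidKernel_prodMk {η : Ω → ℕ → S} (hη : Measurable η)
    {μ : Ω → ProbabilityMeasure S} (hμ : Measurable μ) {Z : Ω → E} (hZ : Measurable Z)
    (h : HasCondDistrib η μ (iidKernel S) P)
    (hex : ∀ τ : Equiv.Perm ℕ, IsFinitePerm τ →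
      P.map (fun ω => (Z ω, fun j => η ω (τ j))) = P.map (fun ω => (Z ω, η ω))) :
    HasCondDistrib η (fun ω => (μ ω, Z ω)) 
      ((iidKernel S).prodMkRight E) P := by
  -- On the event `Z ∈ C` the sequence is still exchangeable, and its directing measure there equals
  -- `μ` by uniqueness. The restriction is not normalized, hence finite measures instead of
  -- probability measures.
  have key : ∀ C, MeasurableSet C → HasCondDistrib η μ (iidKernel S) (P.restrict (Z ⁻¹' C)) := by
    intro C hC
    have hexC : IsExchangeable ((P.restrict (Z ⁻¹' C)).map η) := by
      intro τ hτ
      rw [Measure.map_map (by fun_prop) hη]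
      ext A hA
      have := DFunLike.congr_fun (hex τ hτ) (C ×ˢ A)
      rw [Measure.map_apply (by fun_prop) (hC.prod hA),
        Measure.map_apply (by fun_prop) (hC.prod hA)] at this
      rw [Measure.map_apply (by fun_prop) hA, Measure.map_apply hη hA,
        Measure.restrict_apply (((by fun_prop :
          Measurable ((fun (x : ℕ → S) j => x (τ j)) ∘ η))) hA),
        Measure.restrict_apply (hη hA), Set.inter_comm, Set.inter_comm (η ⁻¹' A)]
      exact this
    have h1 := hexC.hasCondDistrib_directingMeasure hη
    exact hasCondDistrib_congr_ae h1 (ae_eq_of_hasCondDistrib_iidKernel Measure.restrict_le_self.absolutelyContinuous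
      hμ ((measurable_directingMeasure).comp hη) h h1).symm
  refine ⟨by fun_prop, Measure.ext_prod₃' fun {B C A} hB hC hA => ?_⟩
  have h1 := DFunLike.congr_fun (key C hC).map_eq (B ×ˢ A)
  have hg : Measurable fun ν => iidKernel S ν A := (iidKernel S).measurable_coe hA
  rw [Measure.map_apply (by fun_prop) (hB.prod hA), Measure.compProd_apply_prod hB hA,
    setLIntegral_map hB hg hμ, Measure.restrict_restrict (hμ hB),
    Measure.restrict_apply ((hμ.prodMk hη) (hB.prod hA))] at h1
  rw [Measure.map_apply (by fun_prop) ((hB.prod hC).prod hA),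
    Measure.compProd_apply_prod (hB.prod hC) hA]
  simp only [Kernel.prodMkRight_apply]
  rw [setLIntegral_map (f := fun a : ProbabilityMeasure S × E => iidKernel S a.1 A)
    (hB.prod hC) (hg.comp measurable_fst) (hμ.prodMk hZ)]
  refine Eq.trans (congrArg P ?_) h1
  ext ω
  simp only [Set.mem_preimage, Set.mem_prod, Set.mem_inter_iff]
  tauto

end Conditioning

/-! ### Conditional independence of the rows -/

section Array

variable {Ω S : Type*} [MeasurableSpace Ω] [MeasurableSpace S] {P : Measure Ω}
  {ξ : ℕ → ℕ → Ω → S}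

theorem RowExchangeable.map_comp_permute_row (hex : RowExchangeable P ξ)
    (hξ : ∀ i j, Measurable (ξ i j)) (i : ℕ) {τ : Equiv.Perm ℕ} (hτ : IsFinitePerm τ)
    {T : Type*} [MeasurableSpace T] {f : (ℕ → ℕ → S) → T} (hf : Measurable f) :
    P.map (fun ω => f fun k j => ξ k (if k = i then τ j else j) ω) =
      P.map (fun ω => f fun k j => ξ k j ω) := by
  have hone : IsFinitePerm 1 := by simp [IsFinitePerm]
  have h := hex 1 (fun k => if k = i then τ else 1) hone fun k => by split_ifs <;> assumption
  have h' := congrArg (Measure.map f) h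
  rw [Measure.map_map hf (by fun_prop), Measure.map_map hf (by fun_prop)] at h'
  refine Eq.trans (congrArg (fun φ => P.map φ) (funext fun ω => congrArg f ?_)) h'
  ext k j
  split_ifs <;> simp

theorem RowExchangeable.isExchangeable_row (hex : RowExchangeable P ξ)
    (hξ : ∀ i j, Measurable (ξ i j)) (i : ℕ) : IsExchangeable (P.map fun ω j => ξ i j ω) := by
  intro τ hτ
  have h := hex.map_comp_permute_row hξ i hτ (f := fun x : ℕ → ℕ → S => x i)
    (measurable_pi_apply i)
  rw [Measure.map_map (by fun_prop) (by fun_prop)]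
  simpa [Function.comp_def] using h

variable [StandardBorelSpace S] [IsFiniteMeasure P]

theorem IsRowDistributions.ae_eq {μ μ' : ℕ → Ω → ProbabilityMeasure S}
    (h : IsRowDistributions P ξ μ) (h' : IsRowDistributions P ξ μ') (i : ℕ) :
    μ i =ᵐ[P] μ' i :=
  ae_eq_of_hasCondDistrib_iidKernel Measure.AbsolutelyContinuous.rfl (h i).1 (h' i).1
    (h i).2 (h' i).2

variable [Nonempty S]

theorem RowExchangeable.exists_isRowDistributions (hex : RowExchangeable P ξ)
    (hξ : ∀ i j, Measurable (ξ i j)) : ∃ μ, IsRowDistributions P ξ μ :=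
  ⟨fun i ω => directingMeasure (P.map fun ω j => ξ i j ω) fun j => ξ i j ω, fun i =>
    ⟨measurable_directingMeasure.comp (measurable_pi_lambda _ fun j => hξ i j),
      (hex.isExchangeable_row hξ i).hasCondDistrib_directingMeasure
        (measurable_pi_lambda _ fun j => hξ i j)⟩⟩

/-- Given all the row distributions and all the other rows, row `i` is i.i.d. with
distribution `μ i`. -/
theorem IsRowDistributions.hasCondDistrib_row {μ : ℕ → Ω → ProbabilityMeasure S}
    (hμ : IsRowDistributions P ξ μ) (hex : RowExchangeable P ξ)
    (hξ : ∀ i j, Measurable (ξ i j)) (i : ℕ) :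
    HasCondDistrib (fun ω j => ξ i j ω)
      (fun ω => (fun k => μ k ω, fun (k : {k // k ≠ i}) j => ξ k j ω))
      (((iidKernel S).comap (fun ν : ℕ → ProbabilityMeasure S => ν i)
        (measurable_pi_apply i)).prodMkRight ({k // k ≠ i} → ℕ → S)) P := by
  let E := {k // k ≠ i} → ℕ → S
  let Z : Ω → E := fun ω k j => ξ k j ω
  have hZ : Measurable Z := by fun_prop
  have hη : ∀ k, Measurable (fun ω j => ξ k j ω) := fun k => by fun_prop
  have h0 := hasCondDistrib_iidKernel_prodMk (hη i) (hμ i).1 hZ (hμ i).2 fun τ hτ => by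
    have h := hex.map_comp_permute_row hξ i hτ
      (f := fun x : ℕ → ℕ → S => ((fun k => x k : E), x i)) (by fun_prop)
    refine Eq.trans (congrArg (fun φ => P.map φ) (funext fun ω => Prod.ext ?_ ?_)) h
    · ext k j
      simp [Z, k.2]
    · simp
  -- The other row distributions are a.s. functions of their own rows, so conditioning on them as
  -- well adds no information.
  let φ : ProbabilityMeasure S × E → (ℕ → ProbabilityMeasure S) × E := fun p =>
    (fun k => if h : k = i then p.1 else
      directingMeasure (P.map fun ω j => ξ k j ω) (p.2 ⟨k, h⟩), p.2)
  have hφ : Measurable φ := by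
    refine Measurable.prodMk (measurable_pi_lambda _ fun k => ?_) measurable_snd
    split_ifs with h
    · exact measurable_fst
    · exact measurable_directingMeasure.comp ((measurable_pi_apply _).comp measurable_snd)
  have hκ : (((iidKernel S).comap (fun ν : ℕ → ProbabilityMeasure S => ν i)
      (measurable_pi_apply i)).prodMkRight E).comap φ hφ = (iidKernel S).prodMkRight E := by
    ext p : 1
    simp [Kernel.comap_apply, φ]
  rw [← hκ] at h0
  refine hasCondDistrib_congr_ae h0.comp_right ?_
  have hae : ∀ᵐ ω ∂P, ∀ k, μ k ω =
      directingMeasure (P.map fun ω j => ξ k j ω) (fun j => ξ k j ω) :=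
    ae_all_iff.2 fun k => ae_eq_of_hasCondDistrib_iidKernel Measure.AbsolutelyContinuous.rfl
      (hμ k).1 (measurable_directingMeasure.comp (hη k)) (hμ k).2
      ((hex.isExchangeable_row hξ k).hasCondDistrib_directingMeasure (hη k))
  filter_upwards [hae] with ω hω
  refine Prod.ext (funext fun k => ?_) rfl
  simp only [Function.comp_apply, φ, Z]
  split_ifs with h
  · rw [h]
  · exact (hω k).symm

/-- The rows are conditionally independent given the row distributions. -/
theorem IsRowDistributions.lintegral_prod_indicator {μ : ℕ → Ω → ProbabilityMeasure S}
    (hμ : IsRowDistributions P ξ μ) (hex : RowExchangeable P ξ)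
    (hξ : ∀ i j, Measurable (ξ i j)) {A : ℕ → Set (ℕ → S)} (hA : ∀ i, MeasurableSet (A i))
    (s : Finset ℕ) {g : (ℕ → ProbabilityMeasure S) → (ℕ → ℕ → S) → ℝ≥0∞}
    (hg : Measurable (Function.uncurry g)) (hgs : ∀ ν, DependsOn (g ν) (↑s)ᶜ) :
    ∫⁻ ω, g (fun k => μ k ω) (fun k j => ξ k j ω) *
        ∏ i ∈ s, (A i).indicator 1 (fun j => ξ i j ω) ∂P =
      ∫⁻ ω, g (fun k => μ k ω) (fun k j => ξ k j ω) * ∏ i ∈ s, iidKernel S (μ i ω) (A i) ∂P := by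
  classical
  have hi : ∀ i, Measurable ((A i).indicator (1 : (ℕ → S) → ℝ≥0∞)) :=
    fun i => measurable_one.indicator (hA i)
  induction s using Finset.induction_on generalizing g with
  | empty => simp
  | insert i t hit ih =>
    obtain ⟨x₀⟩ := ‹Nonempty S›
    -- The dummy row `x₀` is harmless: `g` does not depend on row `i`. Thus `g` becomes a function
    -- of the conditioning variable of `hasCondDistrib_row`.
    let ext : ({k // k ≠ i} → ℕ → S) → ℕ → ℕ → S := fun y k =>
      if h : k = i then fun _ => x₀ else y ⟨k, h⟩
    have hext : Measurable ext := measurable_pi_lambda _ fun k => by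
      dsimp only [ext]
      split_ifs
      · exact measurable_const
      · exact measurable_pi_apply _
    have hne : ∀ k ∈ t, k ≠ i := fun k hk h => hit (h ▸ hk)
    have hgext : ∀ ν x, g ν (ext fun k => x k) = g ν x := fun ν x => hgs ν fun k hk => by
      have : k ≠ i := fun h => hk (by simp [h])
      simp [ext, this]
    have hgm : Measurable fun p : (ℕ → ProbabilityMeasure S) × ({k // k ≠ i} → ℕ → S) =>
        g p.1 (ext p.2) := hg.comp (measurable_fst.prodMk (hext.comp measurable_snd))
    have h1 := lintegral_mul_indicator_hasCondDistrib (hμ.hasCondDistrib_row hex hξ i)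
      (f := fun p => g p.1 (ext p.2) * ∏ k ∈ t, (A k).indicator 1 (ext p.2 k))
      (hgm.mul (Finset.measurable_prod _ fun k _ => (hi k).comp
        ((measurable_pi_apply k).comp (hext.comp measurable_snd)))) (hA i)
    have h2 : ∀ ω, ∏ k ∈ t, (A k).indicator (1 : (ℕ → S) → ℝ≥0∞)
        (ext (fun (k : {k // k ≠ i}) j => ξ k j ω) k) =
        ∏ k ∈ t, (A k).indicator 1 (fun j => ξ k j ω) := fun ω =>
      Finset.prod_congr rfl fun k hk => by simp [ext, hne k hk]
    have h4 : ∀ ω, g (fun k => μ k ω) (ext fun (k : {k // k ≠ i}) j => ξ k j ω) =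
        g (fun k => μ k ω) (fun k j => ξ k j ω) := fun ω => hgext _ fun k j => ξ k j ω
    simp only [h2, h4, Kernel.prodMkRight_apply,
      Kernel.comap_apply] at h1
    have hm : Measurable fun p : (ℕ → ProbabilityMeasure S) × (ℕ → ℕ → S) =>
        g p.1 p.2 * iidKernel S (p.1 i) (A i) :=
      hg.mul (((iidKernel S).measurable_coe (hA i)).comp
        ((measurable_pi_apply i).comp measurable_fst))
    have h3 := ih (g := fun ν x => g ν x * iidKernel S (ν i) (A i)) hm fun ν x y hxy => by
      have : g ν x = g ν y := hgs ν fun k hk => hxy k fun hkt => hk (by simp [hkt])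
      simp only [this]
    simp only [Finset.prod_insert hit]
    calc _ = _ := lintegral_congr fun ω => by ring
      _ = _ := h1
      _ = _ := lintegral_congr fun ω => by ring
      _ = _ := h3
      _ = _ := lintegral_congr fun ω => by ring

end Array

/-! ### Regular conditional laws of random probability measures -/

section Retract

theorem cdf_isRatStieltjesPoint (ν : Measure ℝ) :
    IsRatStieltjesPoint (id : (ℚ → ℝ) → ℚ → ℝ) fun q => cdf ν q where
  mono := fun q r h => monotone_cdf ν (by exact_mod_cast h)
  tendsto_atTop_one :=
    (tendsto_cdf_atTop ν).comp (tendsto_ratCast_atTop_iff.2 Filter.tendsto_id)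
  tendsto_atBot_zero :=
    (tendsto_cdf_atBot ν).comp (tendsto_ratCast_atBot_iff.2 Filter.tendsto_id)
  iInf_rat_gt_eq := fun t => by
    rw [id, ← (cdf ν).iInf_rat_gt_eq t]
    refine (Equiv.iInf_congr (Equiv.subtypeEquivRight fun q => ?_) fun q => rfl)
    simp

/-- Rebuilds a probability measure on the reals from its distribution function at the rationals. -/
noncomputable def measureOfRatCDF (f : ℚ → ℝ) : Measure ℝ :=
  (stieltjesOfMeasurableRat (id : (ℚ → ℝ) → ℚ → ℝ) measurable_id f).measure

/-- Where `f` is not the trace of a distribution function, the construction uses a default one; this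
makes the retraction defined everywhere. -/
instance (f : ℚ → ℝ) : IsProbabilityMeasure (measureOfRatCDF f) :=
  instIsProbabilityMeasure_stieltjesOfMeasurableRat measurable_id f

theorem measureOfRatCDF_cdf (ν : Measure ℝ) [IsProbabilityMeasure ν] :
    measureOfRatCDF (fun q => cdf ν q) = ν := by
  refine ext_of_generate_finite _
    ((BorelSpace.measurable_eq (α := ℝ)).trans Real.borel_eq_generateFrom_Iic_rat)
    Real.isPiSystem_Iic_rat (fun A hA => ?_) (by simp)
  obtain ⟨q, rfl⟩ : ∃ q : ℚ, A = Set.Iic (q : ℝ) := by simpa [eq_comm] using hA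
  rw [measureOfRatCDF, measure_stieltjesOfMeasurableRat_Iic, stieltjesOfMeasurableRat_eq,
    toRatCDF_of_isRatStieltjesPoint (cdf_isRatStieltjesPoint ν), id, ofReal_cdf]

/-- The space of probability measures on a standard Borel space is a measurable retract of
`ℚ → ℝ`. -/
theorem exists_measurable_retraction_probabilityMeasure (S : Type*) [MeasurableSpace S]
    [StandardBorelSpace S] [Nonempty S] :
    ∃ (i : ProbabilityMeasure S → ℚ → ℝ) (r : (ℚ → ℝ) → ProbabilityMeasure S),
      Measurable i ∧ Measurable r ∧ ∀ ν, r (i ν) = ν := by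
  let e := embeddingReal S
  have he : MeasurableEmbedding e := measurableEmbedding_embeddingReal S
  have hg : Measurable (he.invFun : ℝ → S) := he.measurable_invFun
  have hpe : ∀ ν : ProbabilityMeasure S, IsProbabilityMeasure ((ν : Measure S).map e) :=
    fun ν => Measure.isProbabilityMeasure_map he.measurable.aemeasurable
  refine ⟨fun ν q => cdf ((ν : Measure S).map e) q,
    fun f => ⟨(measureOfRatCDF f).map he.invFun,
      Measure.isProbabilityMeasure_map hg.aemeasurable⟩, ?_, ?_, fun ν => ?_⟩
  · refine measurable_pi_lambda _ fun q => ?_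
    have : ∀ ν : ProbabilityMeasure S, cdf ((ν : Measure S).map e) q =
        ((ν : Measure S) (e ⁻¹' Set.Iic (q : ℝ))).toReal := fun ν => by
      rw [cdf_eq_real, measureReal_def, Measure.map_apply he.measurable measurableSet_Iic]
    simp only [this]
    exact ((Measure.measurable_coe (he.measurable measurableSet_Iic)).comp
      measurable_subtype_coe).ennreal_toReal
  · exact ((Measure.measurable_map _ hg).comp
      (measurable_measure_stieltjesOfMeasurableRat measurable_id)).subtype_mk
  · refine Subtype.ext ?_
    change (measureOfRatCDF fun q => cdf ((ν : Measure S).map e) q).map he.invFun = ν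
    rw [measureOfRatCDF_cdf, Measure.map_map hg he.measurable,
      Function.LeftInverse.comp_eq_id he.leftInverse_invFun, Measure.map_id]

/-- Regular conditional distributions of random probability measures exist. -/
theorem exists_hasCondDistrib_probabilityMeasure {Ω S T : Type*} [MeasurableSpace Ω]
    [MeasurableSpace T] [MeasurableSpace S] [StandardBorelSpace S] [Nonempty S]
    {P : Measure Ω} [IsFiniteMeasure P] {W : Ω → ProbabilityMeasure S} (hW : Measurable W)
    {V : Ω → T} (hV : Measurable V) :
    ∃ Q : Kernel T (ProbabilityMeasure S), IsMarkovKernel Q ∧ HasCondDistrib W V Q P := by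
  obtain ⟨i, r, hi, hr, hri⟩ := exists_measurable_retraction_probabilityMeasure S
  refine ⟨(condDistrib (i ∘ W) V P).map r, Kernel.IsMarkovKernel.map _ hr, ?_⟩
  have h : HasCondDistrib (i ∘ W) V (condDistrib (i ∘ W) V P) P :=
    ⟨by fun_prop, (compProd_map_condDistrib (by fun_prop)).symm⟩
  have h' := h.comp_left hr
  rwa [show r ∘ i ∘ W = W from funext fun ω => hri (W ω)] at h'

end Retract

/-! ### Chain rule and conditional independence for kernels -/

section Disintegration

variable {Ω α β γ : Type*} [MeasurableSpace Ω] [MeasurableSpace α] [MeasurableSpace β]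
  [MeasurableSpace γ] {P : Measure Ω} {X : Ω → α} {Y : Ω → β} {Z : Ω → γ}

theorem hasCondDistrib_compProd {κ : Kernel α β} {η : Kernel (α × β) γ} [IsSFiniteKernel κ]
    [IsSFiniteKernel η] (hY : HasCondDistrib Y X κ P)
    (hZ : HasCondDistrib Z (fun ω => (X ω, Y ω)) η P) :
    HasCondDistrib (fun ω => (Y ω, Z ω)) X (κ ⊗ₖ η) P := by
  have hXm := hY.aemeasurable_fst
  have hYm := hY.aemeasurable_snd
  have hZm := hZ.aemeasurable_snd
  refine ⟨by fun_prop, ?_⟩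
  have h := hZ.map_eq
  rw [hY.map_eq] at h
  have h' := congrArg (Measure.map MeasurableEquiv.prodAssoc) h
  rw [AEMeasurable.map_map_of_aemeasurable (by fun_prop) (by fun_prop),
    Measure.compProd_assoc'] at h'
  exact h'

variable [IsFiniteMeasure P]

theorem hasCondDistrib_dirac {c : β} (hX : AEMeasurable X P) :
    HasCondDistrib (fun _ => c) X (Kernel.const α (Measure.dirac c)) P := by
  refine ⟨by fun_prop, ?_⟩
  rw [Measure.compProd_const, Measure.prod_dirac,
    AEMeasurable.map_map_of_aemeasurable (by fun_prop) hX]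
  rfl

/-- If `Z` is conditionally independent of `Y` given `X`, then also conditioning on `Z` does not
change the conditional law of `Y` given `X`. -/
theorem hasCondDistrib_prodMkRight_of_condIndep {κ : Kernel α β} {η : Kernel α γ}
    [IsFiniteKernel κ] [IsFiniteKernel η] (hX : Measurable X) (hYm : Measurable Y)
    (hZm : Measurable Z) (hY : HasCondDistrib Y X κ P)
    (hZ : HasCondDistrib Z (fun ω => (X ω, Y ω)) (η.prodMkRight β) P) :
    HasCondDistrib Y (fun ω => (X ω, Z ω)) (κ.prodMkRight γ) P := by
  refine ⟨by fun_prop, Measure.ext_prod₃' fun {B C A} hB hC hA => ?_⟩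
  have hκ := κ.measurable_coe hA
  have hη := η.measurable_coe hC
  have iB : Measurable (B.indicator (1 : α → ℝ≥0∞)) := measurable_one.indicator hB
  have iA : Measurable (A.indicator (1 : β → ℝ≥0∞)) := measurable_one.indicator hA
  have h1 := lintegral_mul_indicator_hasCondDistrib hZ
    (f := fun p => B.indicator 1 p.1 * A.indicator 1 p.2) (by fun_prop) hC
  have h2 := lintegral_mul_indicator_hasCondDistrib hY
    (f := fun x => B.indicator 1 x * η x C) (by fun_prop) hA
  have h3 := lintegral_mul_indicator_hasCondDistrib hZ
    (f := fun p => B.indicator 1 p.1 * κ p.1 A) (by fun_prop) hC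
  simp only [Kernel.prodMkRight_apply] at h1 h3
  rw [Measure.map_apply (by fun_prop) ((hB.prod hC).prod hA),
    Measure.compProd_apply_prod (hB.prod hC) hA,
    ← lintegral_indicator_one (((hX.prodMk hZm).prodMk hYm) ((hB.prod hC).prod hA)),
    setLIntegral_map (f := fun a : α × γ => (κ.prodMkRight γ) a A) (hB.prod hC)
      (hκ.comp measurable_fst) (hX.prodMk hZm),
    ← lintegral_indicator ((hX.prodMk hZm) (hB.prod hC))]
  -- Both sides equal the integral of `1_B(X) κ(X, A) η(X, C)`: one by integrating out `Z` and then
  -- `Y`, the other by integrating out `Z` alone.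
  calc _ = _ := lintegral_congr fun ω => ?_
    _ = _ := h1
    _ = _ := lintegral_congr fun ω => by ring
    _ = _ := h2
    _ = _ := lintegral_congr fun ω => by ring
    _ = _ := h3.symm
    _ = _ := lintegral_congr fun ω => ?_
  · by_cases hb : X ω ∈ B <;> by_cases hc : Z ω ∈ C <;> by_cases ha : Y ω ∈ A <;>
      simp [hb, hc, ha]
  · by_cases hb : X ω ∈ B <;> by_cases hc : Z ω ∈ C <;> simp [hb, hc]

end Disintegration

/-! ### Finite blocks of several rows -/

section Blocks

variable {S : Type*} [MeasurableSpace S]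

/-- The law of independent random variables, the `i`-th of which is the image under `r` of an
i.i.d. sequence with marginal distribution `ν i`. -/
noncomputable def blockKernel {T : Type*} [MeasurableSpace T] (r : (ℕ → S) → T)
    (hr : Measurable r) (m : ℕ) : Kernel (Fin m → ProbabilityMeasure S) (Fin m → T) where
  toFun ν := Measure.pi fun i => (iidKernel S).map r (ν i)
  measurable' :=
    haveI := Kernel.IsMarkovKernel.map (iidKernel S) hr
    measurable_pi_of_measurable
      (fun (i : Fin m) (ν : Fin m → ProbabilityMeasure S) => (iidKernel S).map r (ν i))
      fun i => ((iidKernel S).map r).measurable.comp (measurable_pi_apply i)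

theorem blockKernel_apply {T : Type*} [MeasurableSpace T] {r : (ℕ → S) → T}
    (hr : Measurable r) (m : ℕ) (ν : Fin m → ProbabilityMeasure S) :
    blockKernel r hr m ν = Measure.pi fun i => (iidKernel S).map r (ν i) := rfl

instance {T : Type*} [MeasurableSpace T] (r : (ℕ → S) → T) (hr : Measurable r) (m : ℕ) :
    IsMarkovKernel (blockKernel r hr m) :=
  haveI := Kernel.IsMarkovKernel.map (iidKernel S) hr
  ⟨fun ν => inferInstanceAs (IsProbabilityMeasure (Measure.pi fun i => (iidKernel S).map r (ν i)))⟩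

theorem iidKernel_map_injective {J : Type*} [Fintype J] {e : J → ℕ} (he : e.Injective)
    (ν : ProbabilityMeasure S) :
    (iidKernel S).map (fun x j => x (e j)) ν = Measure.pi fun _ : J => (ν : Measure S) := by
  rw [Kernel.map_apply _ (by fun_prop), iidKernel_apply,
    Measure.map_infinitePi_infinitePi_of_inj (P := fun _ : ℕ => (ν : Measure S)) he,
    Measure.infinitePi_eq_pi]

theorem iidKernel_map_disjoint {J K : Type*} [Fintype J] [Fintype K] {e : J → ℕ} {f : K → ℕ}
    (he : e.Injective) (hf : f.Injective) (hef : ∀ j k, e j ≠ f k) (ν : ProbabilityMeasure S) :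
    (iidKernel S).map (fun x => ((fun j => x (e j) : J → S), (fun k => x (f k) : K → S))) ν =
      (Measure.pi fun _ : J => (ν : Measure S)).prod (Measure.pi fun _ : K => (ν : Measure S)) := by
  have h := iidKernel_map_injective (he.sumElim hf hef) ν
  have hp := measurePreserving_sumPiEquivProdPi (fun _ : J ⊕ K => (ν : Measure S))
  rw [← hp.map_eq, ← h, Kernel.map_apply _ (by fun_prop), Kernel.map_apply _ (by fun_prop),
    Measure.map_map (by fun_prop) (by fun_prop)]
  rfl

variable {Ω : Type*} [MeasurableSpace Ω] [StandardBorelSpace S] [Nonempty S] {P : Measure Ω}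
  [IsFiniteMeasure P] {ξ : ℕ → ℕ → Ω → S} {μ : ℕ → Ω → ProbabilityMeasure S}

/-- The conditioning variable `F` may use all row distributions and the rows from `m` on, provided
that `p` recovers the first `m` row distributions from it. This covers both the stage input together
with `μ m`, and the row distributions alone. -/
theorem IsRowDistributions.hasCondDistrib_block (hμ : IsRowDistributions P ξ μ)
    (hex : RowExchangeable P ξ) (hξ : ∀ i j, Measurable (ξ i j))
    {T E : Type*} [MeasurableSpace T] [MeasurableSpace E] {r : (ℕ → S) → T} (hr : Measurable r)
    (m : ℕ) {F : (ℕ → ProbabilityMeasure S) → (ℕ → ℕ → S) → E}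
    (hF : Measurable (Function.uncurry F))
    (hFm : ∀ ν, DependsOn (F ν) (↑(Finset.range m))ᶜ) {p : E → Fin m → ProbabilityMeasure S}
    (hp : Measurable p) (hpF : ∀ ν x (i : Fin m), p (F ν x) i = ν i) :
    HasCondDistrib (fun ω (i : Fin m) => r fun j => ξ i j ω)
      (fun ω => F (fun k => μ k ω) fun k j => ξ k j ω) ((blockKernel r hr m).comap p hp) P := by
  have := Kernel.IsMarkovKernel.map (iidKernel S) hr
  have hμm := fun k => (hμ k).1
  refine hasCondDistrib_of_lintegral
    (hF.comp (g := Function.uncurry F) (f := fun ω => (fun k => μ k ω, fun k j => ξ k j ω))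
      (by fun_prop)) (by fun_prop) generateFrom_pi.symm isPiSystem_pi
    ⟨fun _ => Set.univ, by simp, by simp⟩ ?_
  rintro f hf _ ⟨B, hB, rfl⟩
  have hB' : ∀ i, MeasurableSet (B i) := fun i => hB i (Set.mem_univ i)
  let A : ℕ → Set (ℕ → S) := fun i => if h : i < m then r ⁻¹' B ⟨i, h⟩ else Set.univ
  have hA : ∀ i, MeasurableSet (A i) := fun i => by
    dsimp only [A]
    split_ifs
    exacts [hr (hB' _), MeasurableSet.univ]
  have h := hμ.lintegral_prod_indicator hex hξ hA (Finset.range m)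
    (g := fun ν x => f (F ν x)) (hf.comp hF) fun ν x y hxy => congrArg f (hFm ν hxy)
  simp only [Finset.prod_range] at h
  refine Eq.trans (lintegral_congr fun ω => ?_) (h.trans (lintegral_congr fun ω => ?_))
  · congr 1
    by_cases hω : ∀ i : Fin m, r (fun j => ξ i j ω) ∈ B i
    · rw [Set.indicator_of_mem (by simpa using hω)]
      refine (Finset.prod_eq_one fun i _ => ?_).symm
      rw [Set.indicator_of_mem (by simpa [A] using hω i)]
      rfl
    · rw [Set.indicator_of_notMem (by simpa using hω)]
      push Not at hω
      obtain ⟨i, hi⟩ := hω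
      refine (Finset.prod_eq_zero (Finset.mem_univ i) ?_).symm
      rw [Set.indicator_of_notMem (by simpa [A] using hi)]
  · congr 1
    rw [Kernel.comap_apply, blockKernel_apply, Measure.pi_pi]
    refine Finset.prod_congr rfl fun i _ => ?_
    rw [Kernel.map_apply' _ hr _ (hB' i), hpF]
    simp [A]

end Blocks

/-! ### Posterior of the row distributions and prediction -/

section Prediction

variable {S : Type*} [MeasurableSpace S]

theorem measurable_finSnoc {T : Type*} [MeasurableSpace T] (m : ℕ) :
    Measurable fun p : (Fin m → T) × T => (Fin.snoc p.1 p.2 : Fin (m + 1) → T) := by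
  refine measurable_pi_lambda _ fun k => ?_
  refine Fin.lastCases ?_ (fun k => ?_) k
  · simpa using measurable_snd
  · simpa [Function.comp_def] using (measurable_pi_apply k).comp measurable_fst

theorem measurable_dataMatrix {Ω : Type*} [MeasurableSpace Ω] {ξ : ℕ → ℕ → Ω → S}
    (hξ : ∀ i j, Measurable (ξ i j)) (M N : ℕ) :
    Measurable (dataMatrix ξ M N) := by
  unfold dataMatrix
  fun_prop

instance isMarkovKernel_jointKernel {M N : ℕ}
    (Q : (m : Fin M) → Kernel (StageInput S M N m) (ProbabilityMeasure S))
    [∀ m, IsMarkovKernel (Q m)] (m : ℕ) (h : m ≤ M) : IsMarkovKernel (jointKernel Q m h) := by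
  induction m with
  | zero => exact inferInstanceAs (IsMarkovKernel (Kernel.const _ (Measure.dirac _)))
  | succ m ih =>
    have := ih (Nat.le_of_succ_le h)
    exact Kernel.IsMarkovKernel.map _ (measurable_finSnoc m)

instance isMarkovKernel_productKernel (M N N' : ℕ) : IsMarkovKernel (productKernel S M N N') :=
  ⟨fun ν => inferInstanceAs (IsProbabilityMeasure (Measure.pi fun i =>
    Measure.pi fun _ : Finset.Ico N N' => (ν i : Measure S)))⟩

instance isMarkovKernel_predictiveKernel {M N : ℕ} (N' : ℕ)
    (Q : (m : Fin M) → Kernel (StageInput S M N m) (ProbabilityMeasure S))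
    [∀ m, IsMarkovKernel (Q m)] : IsMarkovKernel (predictiveKernel N' Q) := by
  unfold predictiveKernel
  infer_instance

variable {Ω : Type*} [MeasurableSpace Ω] [StandardBorelSpace S] [Nonempty S] {P : Measure Ω}
  [IsFiniteMeasure P] {ξ : ℕ → ℕ → Ω → S} {μ : ℕ → Ω → ProbabilityMeasure S}

/-- Data in a row before `m` carry no information on `μ m` once that row's distribution is known, so
conditioning on the full data matrix does not change the kernel. -/
theorem IsRowDistributions.hasCondDistrib_stage (hμ : IsRowDistributions P ξ μ)
    (hex : RowExchangeable P ξ) (hξ : ∀ i j, Measurable (ξ i j)) {M N : ℕ} (m : Fin M)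
    {Q : Kernel (StageInput S M N m) (ProbabilityMeasure S)} [IsMarkovKernel Q]
    (hQ : HasCondDistrib (μ m) (stageInput ξ μ M N m) Q P) :
    HasCondDistrib (μ m) (fun ω => (dataMatrix ξ M N ω, fun k : Fin m => μ k ω))
      (Q.comap (restrictInput M N m) (measurable_restrictInput M N m)) P := by
  have hμm := fun k => (hμ k).1
  let r : (ℕ → S) → Fin N → S := fun x j => x j
  have hr : Measurable r := by fun_prop
  have hU := hμ.hasCondDistrib_block hex hξ hr m
    (F := fun ν x => (((fun i j => x i.1 j, fun k => ν k) : StageInput S M N m), ν m))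
    (by fun_prop)
    (fun ν x y hxy => by
      have : ∀ i : {i : Fin M // m ≤ i}, x i.1 = y i.1 := fun i => hxy i.1 (by simpa using i.2)
      simp [this])
    (p := fun q => q.1.2) (by fun_prop) (fun ν x i => rfl)
  have hV : Measurable (stageInput ξ μ M N m) := by
    unfold stageInput
    fun_prop
  have hW := hasCondDistrib_prodMkRight_of_condIndep
    (η := (blockKernel r hr m).comap Prod.snd measurable_snd) hV (hμm m) (by fun_prop) hQ hU
  -- Reassembles the data matrix from the rows in the stage input and the earlier rows.
  let φ : StageInput S M N m × (Fin m → Fin N → S) →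
      DataMatrix S M N × (Fin m → ProbabilityMeasure S) := fun q =>
    (fun i => if h : m ≤ i then q.1.1 ⟨i, h⟩ else q.2 ⟨i, not_le.1 h⟩, q.1.2)
  have hφ : Measurable φ := by
    refine Measurable.prodMk (measurable_pi_lambda _ fun i => ?_) (by fun_prop)
    split_ifs <;> fun_prop
  have hκ : (Q.comap (restrictInput M N m) (measurable_restrictInput M N m)).comap φ hφ =
      Q.prodMkRight (Fin m → Fin N → S) := by
    ext q : 1
    have : restrictInput M N m (φ q) = q.1 :=
      Prod.ext (funext fun i => by simp [restrictInput, φ, i.2]) rfl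
    rw [Kernel.comap_apply, Kernel.comap_apply, this, Kernel.prodMkRight_apply]
  rw [← hκ] at hW
  convert hW.comp_right using 1
  funext ω
  refine Prod.ext (funext fun i => ?_) rfl
  simp only [Function.comp_apply, φ, stageInput, r]
  split_ifs <;> rfl

theorem IsRowDistributions.hasCondDistrib_jointKernel (hμ : IsRowDistributions P ξ μ)
    (hex : RowExchangeable P ξ) (hξ : ∀ i j, Measurable (ξ i j)) {M N : ℕ}
    {Q : (m : Fin M) → Kernel (StageInput S M N m) (ProbabilityMeasure S)}
    [∀ m, IsMarkovKernel (Q m)]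
    (hQ : ∀ m : Fin M, HasCondDistrib (μ m) (stageInput ξ μ M N m) (Q m) P) (m : ℕ)
    (h : m ≤ M) :
    HasCondDistrib (fun ω (k : Fin m) => μ k ω) (dataMatrix ξ M N) (jointKernel Q m h) P := by
  induction m with
  | zero =>
    have h0 : (fun ω (k : Fin 0) => μ k ω) = fun _ => Fin.elim0 :=
      funext fun ω => Subsingleton.elim _ _
    rw [h0]
    exact hasCondDistrib_dirac (measurable_dataMatrix hξ M N).aemeasurable
  | succ m ih =>
    have h1 := hasCondDistrib_compProd (ih (Nat.le_of_succ_le h))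
      (hμ.hasCondDistrib_stage hex hξ ⟨m, h⟩ (hQ ⟨m, h⟩))
    have h2 := h1.comp_left (measurable_finSnoc (T := ProbabilityMeasure S) m)
    have h3 : (fun ω (k : Fin (m + 1)) => μ k ω) =
        (fun p : (Fin m → ProbabilityMeasure S) × ProbabilityMeasure S =>
          (Fin.snoc p.1 p.2 : Fin (m + 1) → ProbabilityMeasure S)) ∘
            fun ω => (fun k : Fin m => μ k ω, μ m ω) := by
      funext ω k
      refine Fin.lastCases ?_ (fun k => ?_) k <;> simp
    rw [h3]
    exact h2

/-- Given the row distributions, the observed and future blocks are independent, because their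
columns are disjoint. Their joint conditional law is thus a composition-product whose second factor
ignores the data, and disintegrating it gives the claim. -/
theorem IsRowDistributions.hasCondDistrib_futureEntries (hμ : IsRowDistributions P ξ μ)
    (hex : RowExchangeable P ξ) (hξ : ∀ i j, Measurable (ξ i j)) (M N N' : ℕ) :
    HasCondDistrib (futureEntries ξ M N N')
      (fun ω => (dataMatrix ξ M N ω, fun k : Fin M => μ k ω))
      ((productKernel S M N N').prodMkLeft (DataMatrix S M N)) P := by
  let J := Fin N
  let K := Finset.Ico N N'
  let r : (ℕ → S) → (J → S) × (K → S) := fun x => (fun j => x j, fun k => x k)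
  have hr : Measurable r := by fun_prop
  have hrJ : Measurable fun (x : ℕ → S) (j : J) => x j := by fun_prop
  have h0 := hμ.hasCondDistrib_block hex hξ hr M (F := fun ν x (k : Fin M) => ν k)
    (by fun_prop) (fun ν x y _ => rfl) (p := id) measurable_id (fun ν x i => rfl)
  -- Turns a family of pairs (observed, future), one per row, into the pair of the two matrices.
  let u := MeasurableEquiv.arrowProdEquivProdArrow (J → S) (K → S) (Fin M)
  have h1 := h0.comp_left u.measurable
  have hk : (((blockKernel r hr M).comap id measurable_id).map u) =
      blockKernel (fun (x : ℕ → S) (j : J) => x j) hrJ M ⊗ₖ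
        (productKernel S M N N').prodMkRight (Fin M → J → S) := by
    ext ν : 1
    have hd : ∀ i, (iidKernel S).map r (ν i) =
        (Measure.pi fun _ : J => (ν i : Measure S)).prod
          (Measure.pi fun _ : K => (ν i : Measure S)) := fun i =>
      iidKernel_map_disjoint Fin.val_injective Subtype.val_injective
        (fun j k h => by
          have := Finset.mem_Ico.1 k.2
          omega) (ν i)
    have hJ : ∀ i, (iidKernel S).map (fun (x : ℕ → S) (j : J) => x j) (ν i) =
        Measure.pi fun _ : J => (ν i : Measure S) :=
      fun i => iidKernel_map_injective Fin.val_injective (ν i)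
    rw [Kernel.map_apply _ u.measurable, Kernel.comap_apply, id, blockKernel_apply]
    simp only [hd]
    rw [(measurePreserving_arrowProdEquivProdArrow (J → S) (K → S) (Fin M) _ _).map_eq,
      Kernel.compProd_apply_eq_compProd_sectR, blockKernel_apply]
    simp only [hJ]
    rw [← Measure.compProd_const]
    rfl
  rw [hk] at h1
  have h2 := HasCondDistrib.of_compProd (Y := dataMatrix ξ M N) (Z := futureEntries ξ M N N') h1
  exact h2.measurableEquiv_comp_right MeasurableEquiv.prodComm

theorem IsRowDistributions.hasCondDistrib_predictiveKernel (hμ : IsRowDistributions P ξ μ)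
    (hex : RowExchangeable P ξ) (hξ : ∀ i j, Measurable (ξ i j)) {M N : ℕ} (N' : ℕ)
    {Q : (m : Fin M) → Kernel (StageInput S M N m) (ProbabilityMeasure S)}
    [∀ m, IsMarkovKernel (Q m)]
    (hQ : ∀ m : Fin M, HasCondDistrib (μ m) (stageInput ξ μ M N m) (Q m) P) :
    HasCondDistrib (futureEntries ξ M N N') (dataMatrix ξ M N) (predictiveKernel N' Q) P := by
  have h := (hasCondDistrib_compProd (hμ.hasCondDistrib_jointKernel hex hξ hQ M le_rfl)
    (hμ.hasCondDistrib_futureEntries hex hξ M N N')).snd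
  rwa [Kernel.snd_compProd_prodMkLeft] at h

end Prediction

/-- The posterior predictive law of a row exchangeable array is computed, by a map that does not
depend on the array, from the conditional laws of the row distributions. -/
theorem theorem1p2 {Ω S : Type*} [MeasurableSpace Ω] (P : Measure Ω) [IsProbabilityMeasure P]
    [MetricSpace S] [CompleteSpace S] [TopologicalSpace.SeparableSpace S]
    [MeasurableSpace S] [BorelSpace S]
    (ξ : ℕ → ℕ → Ω → S) (hξ : ∀ i j, Measurable (ξ i j)) (hex : RowExchangeable P ξ) :
    -- the row distributions exist and are almost surely unique
    (∃ μ, IsRowDistributions P ξ μ) ∧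
    (∀ μ μ', IsRowDistributions P ξ μ → IsRowDistributions P ξ μ' → ∀ i, μ i =ᵐ[P] μ' i) ∧
    ∀ μ, IsRowDistributions P ξ μ → ∀ M N N' : ℕ, N < N' →
      -- the conditional laws of `μ m` given the stage `m` input exist as probability kernels
      (∀ m : Fin M, ∃ Q : Kernel (StageInput S M N m) (ProbabilityMeasure S),
        IsMarkovKernel Q ∧ HasCondDistrib (μ m) (stageInput ξ μ M N m) Q P) ∧
      -- and any versions of them determine the conditional law of the future given the data
      ∀ Q : (m : Fin M) → Kernel (StageInput S M N m) (ProbabilityMeasure S),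
        (∀ m, IsMarkovKernel (Q m)) →
        (∀ m : Fin M, HasCondDistrib (μ m) (stageInput ξ μ M N m) (Q m) P) →
        IsMarkovKernel (predictiveKernel N' Q) ∧
        HasCondDistrib (futureEntries ξ M N N') (dataMatrix ξ M N) (predictiveKernel N' Q) P := by
  have : Nonempty S := by
    have : Nonempty Ω := nonempty_of_isProbabilityMeasure P
    exact this.map (ξ 0 0)
  refine ⟨hex.exists_isRowDistributions hξ, fun μ μ' hμ hμ' i => hμ.ae_eq hμ' i,
    fun μ hμ M N N' _ => ⟨fun m => ?_, fun Q hQm hQ =>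
      ⟨inferInstance, hμ.hasCondDistrib_predictiveKernel hex hξ N' hQ⟩⟩⟩
  have hμm := fun k => (hμ k).1
  refine exists_hasCondDistrib_probabilityMeasure (hμm m) ?_
  unfold stageInput
  fun_prop
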